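/- Let $r\ge 1$ and $s\ge 2$ be integers. Let $\mathrm{Diff}^r_+(S^1)$ be the set of orientation preserving $C^r$-diffeomorphisms of the circle $S^1=\mathbb R/\mathbb Z$ with the $C^r$-topology, and let $S\subset(\mathrm{Diff}^r_+(S^1))^s$, with the subspace topology of the product topology, be the set of tuples $F=(f_1,\dots,f_s)$ such that $f_1$ is Morse–Smale, i.e. the set of periodic points of $f_1$ is non-empty and finite and all of them are hyperbolic. A tuple $F\in S$ is identified with the step skew product $$F:\Sigma^s\times S^1\to\Sigma^s\times S^1,\qquad F(\omega,p)=(\sigma\omega,f_{\omega_0}(p)),$$ where $\Sigma^s=\{1,\dots,s\}^{\mathbb Z}$ carries the product topology and $(\sigma\omega)_n=\omega_{n+1}$. A closed set $A\subset X$ with $F(A)\subset A$ is Lyapunov stable for a map $F:X\to X$ if for every neighbourhood $U$ of $A$ there is a neighbourhood $V\subset U$ of $A$ such that $F^n(V)\subset U$ for all $n\ge 0$. A closed set $B\subset S^1$ is called Lyapunov stable for the step skew product $F$ if $\Sigma^s\times B$ is Lyapunov stable for $F$. A sink of $f_1$ is a periodic point $a$ of $f_1$, of least period $p$ say, with $|(f_1^p)'(a)|<1$.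 For a point $a\in S^1$ let $\overline{\mathrm{orb}}(a)$ be the closure of the orbit of $a$ under the semigroup generated by $f_1,\dots,f_s$ under composition. Then the set of those $F\in S$ such that for every sink $a$ of $f_1$ the set $\overline{\mathrm{orb}}(a)$ is Lyapunov stable for $F$ is residual in $S$, i.e. it contains a countable intersection of open dense subsets of $S$. -/

import Mathlib

open Set Topology

/-! ### Circle diffeomorphisms and the `C^r`-topology

The circle is `S¹ = ℝ / ℤ`.  The projection `ℝ → ℝ / ℤ` is a local diffeomorphism, so a continuous
self-map of the circle is of class `C^r` exactly when its lifts to `ℝ` are. -/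

/-- An orientation preserving `C^r`-diffeomorphism of the circle `ℝ / ℤ`: a homeomorphism `f` with
an increasing lift of class `C^r`, whose inverse also has a lift of class `C^r`. -/
structure CircleDiffeo (r : ℕ) extends UnitAddCircle ≃ₜ UnitAddCircle where
  exists_lift : ∃ F : ℝ → ℝ, ContDiff ℝ r F ∧ StrictMono F ∧
    ∀ x : ℝ, (F x : UnitAddCircle) = toFun (x : UnitAddCircle)
  exists_lift_symm : ∃ G : ℝ → ℝ, ContDiff ℝ r G ∧
    ∀ x : ℝ, (G x : UnitAddCircle) = invFun (x : UnitAddCircle)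

namespace CircleDiffeo

variable {r : ℕ}

instance : CoeFun (CircleDiffeo r) (fun _ => UnitAddCircle → UnitAddCircle) :=
  ⟨fun f => f.toHomeomorph⟩

/-- A lift of `f` to the real line.  All continuous lifts differ by integer constants
(`CircleDiffeo.lift_unique`), so the derivatives of the lift depend only on `f`. -/
noncomputable def lift (f : CircleDiffeo r) : ℝ → ℝ := f.exists_lift.choose

theorem contDiff_lift (f : CircleDiffeo r) : ContDiff ℝ r f.lift := f.exists_lift.choose_spec.1

theorem strictMono_lift (f : CircleDiffeo r) : StrictMono f.lift := f.exists_lift.choose_spec.2.1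

theorem coe_lift (f : CircleDiffeo r) (x : ℝ) :
    (f.lift x : UnitAddCircle) = f (x : UnitAddCircle) := f.exists_lift.choose_spec.2.2 x

theorem lift_unique (f : CircleDiffeo r) (G : ℝ → ℝ) (hG : Continuous G)
    (h : ∀ x : ℝ, (G x : UnitAddCircle) = f (x : UnitAddCircle)) :
    ∃ n : ℤ, ∀ x, G x = f.lift x + n := by
  have key : ∀ x, ∃ n : ℤ, (n : ℝ) = G x - f.lift x := by
    intro x
    have h1 : ((G x - f.lift x : ℝ) : UnitAddCircle) = 0 := by
      rw [AddCircle.coe_sub, h, coe_lift, sub_self]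
    obtain ⟨n, hn⟩ := (AddCircle.coe_eq_zero_iff (1 : ℝ)).1 h1
    exact ⟨n, by simpa using hn⟩
  choose n hn using key
  have hcont : Continuous n := by
    rw [Int.isClosedEmbedding_coe_real.isEmbedding.continuous_iff]
    exact (hG.sub f.contDiff_lift.continuous).congr fun x => (hn x).symm
  refine ⟨n 0, fun x => ?_⟩
  have h2 : n x = n 0 := PreconnectedSpace.constant inferInstance hcont
  rw [← h2, hn x]
  ring

/-- The `C^r`-topology: uniform convergence of the maps on the circle together with uniform
convergence of their derivatives of orders `1, …, r`. -/
noncomputable instance : TopologicalSpace (CircleDiffeo r) :=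
  TopologicalSpace.induced
    (fun f => ((UniformFun.ofFun (f : UnitAddCircle → UnitAddCircle) :
        UniformFun UnitAddCircle UnitAddCircle),
      fun k : Fin r => (UniformFun.ofFun (iteratedDeriv (k + 1) f.lift) : UniformFun ℝ ℝ)))
    inferInstance

/-- The multiplier `(f^p)'(a)` of a periodic point `a` of least period `p`, computed in the lift at
the representative of `a` in `[0, 1)` (for a non-periodic point `p = 0` and the value is `1`). -/
noncomputable def multiplier (f : CircleDiffeo r) (a : UnitAddCircle) : ℝ :=
  deriv (f.lift^[Function.minimalPeriod f a]) (AddCircle.equivIco (1 : ℝ) 0 a : ℝ)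

/-- A sink is a hyperbolic attracting periodic point. -/
def IsSink (f : CircleDiffeo r) (a : UnitAddCircle) : Prop :=
  a ∈ Function.periodicPts f ∧ |f.multiplier a| < 1

/-- A Morse–Smale diffeomorphism of the circle: periodic points exist, there are finitely many of
them, and each of them is hyperbolic. -/
def IsMorseSmale (f : CircleDiffeo r) : Prop :=
  (Function.periodicPts f).Nonempty ∧ (Function.periodicPts f).Finite ∧
    ∀ a ∈ Function.periodicPts f, |f.multiplier a| ≠ 1

end CircleDiffeo

/-! ### Step skew products, semigroup orbits, Lyapunov stability -/

/-- The step skew product `(ω, p) ↦ (σ ω, f_{ω₀} p)` over the Bernoulli shift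
`(σ ω)ₙ = ωₙ₊₁` on bi-infinite sequences of `s` symbols. -/
def stepSkewProduct {s : ℕ} {M : Type*} (f : Fin s → M → M) :
    (ℤ → Fin s) × M → (ℤ → Fin s) × M :=
  fun x => (fun n => x.1 (n + 1), f (x.1 0) x.2)

/-- The orbit of `a` under the semigroup (with respect to composition) generated by the maps
`f i`. -/
def semigroupOrbit {s : ℕ} {M : Type*} (f : Fin s → M → M) (a : M) : Set M :=
  {y | ∃ g ∈ (Subsemigroup.closure (Set.range f) : Subsemigroup (Function.End M)), y = g a}

/-- A closed absorbing set `A` is Lyapunov stable if every neighbourhood `U` of `A` contains a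
neighbourhood `V` of `A` such that forward trajectories starting in `V` never leave `U`. -/
def IsLyapunovStable {X : Type*} [TopologicalSpace X] (F : X → X) (A : Set X) : Prop :=
  IsClosed A ∧ MapsTo F A A ∧
    ∀ U ∈ 𝓝ˢ A, ∃ V ∈ 𝓝ˢ A, V ⊆ U ∧ ∀ x ∈ V, ∀ n : ℕ, F^[n] x ∈ U

/-- A subset `B` of the fiber is Lyapunov stable for the step skew product with fiber maps `f` if
its full preimage `Σˢ × B` is. -/
def IsFiberLyapunovStable {s : ℕ} {M : Type*} [TopologicalSpace M] (f : Fin s → M → M)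
    (B : Set M) : Prop :=
  IsLyapunovStable (stepSkewProduct f) ((univ : Set (ℤ → Fin s)) ×ˢ B)

/-- The space `S` of (tuples of fiber maps of) step skew products with circle fiber and `s`
orientation preserving `C^r` fiber maps, the map number `i` being Morse–Smale, with the subspace
topology of the `s`-th power of the `C^r`-topology. -/
abbrev MorseSmaleSSP (r s : ℕ) (i : Fin s) : Type :=
  {f : Fin s → CircleDiffeo r // (f i).IsMorseSmale}

/-! Write `i₀` for the index of the Morse–Smale map, `K` for the orbit closure of a sink `a`, and
call a point safe for an open `U ⊇ K` if no word takes it out of `U`. Stability of `K` follows once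
`K` lies in the interior `O` of the safe set, for every such `U`.

Genericity. For basic open `b` and a finite union `V` of basic open sets, the systems having a word
that maps `closure b` into `V` form an open set `G`, and `G ∪ interior Gᶜ` is open and dense. There
are countably many pairs `(b, V)`, so for a generic system the absence of such a word persists under
perturbation (`eventually_residual_not_mapsTo`). Take `V` covering the complement of `U` and missing
`K`, and `b` a small neighbourhood of `a`. Rotating all maps except number `i₀` by a small `t` keeps
the sink and its basin. If the rotated orbit of `a` met `V`, applying the map `i₀` many times
beforehand would carry `closure b` into `V`. Hence the orbits of `a` under all small rotations avoid
`V`.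

From rotations to neighbourhoods. Lifts are increasing, so by the intermediate value theorem an
error `δ` made right after a letter other than `i₀` can be replaced by a rotation by some `t` with
`|t| ≤ |δ|` (`exists_shiftLifts_eq`). So all limits of points reached by a last letter other than
`i₀` lie in `O` (`subset_interior_safeSet_of_twist`).

The rest of `K`. If `K \ O` is nonempty, it is closed and invariant under the map `i₀`, hence
contains a periodic point. An attracting one would be in `O`, since nearby points follow its cycle
until another letter sends them into `O`. A repelling one cannot be in `K`, since the orbit of `a`
could enter its neighbourhood only by another letter, that is, through points of `O`. -/

/-! ### Words in the generators of a semigroup -/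

section Words

variable {s : ℕ} {M : Type*}

/-- The composition of the maps `f i` along a word, the last letter being applied first. -/
def wordAct (f : Fin s → M → M) (w : List (Fin s)) (x : M) : M :=
  w.foldr (fun i y => f i y) x

@[simp] theorem wordAct_nil (f : Fin s → M → M) (x : M) : wordAct f [] x = x := rfl

@[simp] theorem wordAct_cons (f : Fin s → M → M) (i : Fin s) (w : List (Fin s)) (x : M) :
    wordAct f (i :: w) x = f i (wordAct f w x) := rfl

theorem wordAct_append (f : Fin s → M → M) (w v : List (Fin s)) (x : M) :
    wordAct f (w ++ v) x = wordAct f w (wordAct f v x) := by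
  simp [wordAct]

theorem wordAct_replicate (f : Fin s → M → M) (i : Fin s) (n : ℕ) (x : M) :
    wordAct f (List.replicate n i) x = (f i)^[n] x := by
  induction n with
  | zero => rfl
  | succ n ih => rw [List.replicate_succ, wordAct_cons, ih, Function.iterate_succ_apply']

theorem mem_semigroupOrbit_iff (f : Fin s → M → M) (a y : M) :
    y ∈ semigroupOrbit f a ↔ ∃ w : List (Fin s), w ≠ [] ∧ y = wordAct f w a := by
  constructor
  · rintro ⟨g, hg, rfl⟩
    suffices h : ∃ w : List (Fin s), w ≠ [] ∧ ∀ x, g x = wordAct f w x by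
      obtain ⟨w, hw, h⟩ := h
      exact ⟨w, hw, h a⟩
    induction hg using Subsemigroup.closure_induction with
    | mem g hg =>
      obtain ⟨i, rfl⟩ := hg
      exact ⟨[i], by simp, fun x => rfl⟩
    | mul g h _ _ ihg ihh =>
      obtain ⟨w, hw, hg⟩ := ihg
      obtain ⟨v, hv, hh⟩ := ihh
      refine ⟨w ++ v, by simp [hw], fun x => ?_⟩
      rw [wordAct_append, ← hh, ← hg]
      rfl
  · rintro ⟨w, hw, rfl⟩
    suffices h : ∃ g ∈ (Subsemigroup.closure (Set.range f) : Subsemigroup (Function.End M)),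
        ∀ x, wordAct f w x = g x by
      obtain ⟨g, hg, h⟩ := h
      exact ⟨g, hg, h a⟩
    induction w with
    | nil => exact absurd rfl hw
    | cons i w ih =>
      have hi : (f i : Function.End M) ∈
          (Subsemigroup.closure (Set.range f) : Subsemigroup (Function.End M)) :=
        Subsemigroup.subset_closure ⟨i, rfl⟩
      by_cases hw' : w = []
      · subst hw'
        exact ⟨f i, hi, fun x => rfl⟩
      · obtain ⟨g, hg, h⟩ := ih hw'
        let fi : Function.End M := f i
        refine ⟨fi * g, mul_mem hi hg, fun x => ?_⟩
        rw [wordAct_cons, h]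
        rfl

theorem wordAct_mem_semigroupOrbit (f : Fin s → M → M) (a : M) {w : List (Fin s)} (hw : w ≠ []) :
    wordAct f w a ∈ semigroupOrbit f a :=
  (mem_semigroupOrbit_iff f a _).2 ⟨w, hw, rfl⟩

theorem mapsTo_semigroupOrbit (f : Fin s → M → M) (a : M) (i : Fin s) :
    MapsTo (f i) (semigroupOrbit f a) (semigroupOrbit f a) := by
  intro y hy
  obtain ⟨w, _, rfl⟩ := (mem_semigroupOrbit_iff f a y).1 hy
  exact wordAct_mem_semigroupOrbit f a (List.cons_ne_nil i w)

/-- A periodic point of a generator belongs to its own semigroup orbit. -/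
theorem self_mem_semigroupOrbit (f : Fin s → M → M) {a : M} {i : Fin s}
    (ha : a ∈ Function.periodicPts (f i)) : a ∈ semigroupOrbit f a := by
  obtain ⟨n, hn, h⟩ := ha
  refine (mem_semigroupOrbit_iff f a a).2 ⟨List.replicate n i, ?_, ?_⟩
  · simpa using hn.ne'
  · rw [wordAct_replicate, h.eq]

theorem iterate_fst_snd_stepSkewProduct_mem {f : Fin s → M → M} {W : Set M}
    (hW : ∀ i, MapsTo (f i) W W) (n : ℕ) (x : (ℤ → Fin s) × M) (hx : x.2 ∈ W) :
    ((stepSkewProduct f)^[n] x).2 ∈ W := by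
  induction n generalizing x with
  | zero => exact hx
  | succ n ih =>
    rw [Function.iterate_succ_apply]
    exact ih _ (hW _ hx)

/-- The points whose forward trajectories under all words stay in `U`. -/
def safeSet (f : Fin s → M → M) (U : Set M) : Set M := {x | ∀ w, wordAct f w x ∈ U}

theorem safeSet_subset (f : Fin s → M → M) (U : Set M) : safeSet f U ⊆ U := fun _ hx => hx []

theorem mapsTo_safeSet (f : Fin s → M → M) (U : Set M) (i : Fin s) :
    MapsTo (f i) (safeSet f U) (safeSet f U) := by
  intro x hx w
  have := hx (w ++ [i])
  rwa [wordAct_append] at this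

/-- A subset of `U` which can only be left through the safe set is safe. -/
theorem subset_safeSet {f : Fin s → M → M} {U Z : Set M} (hU : Z ⊆ U)
    (h : ∀ x ∈ Z, ∀ i, f i x ∈ Z ∪ safeSet f U) : Z ⊆ safeSet f U := by
  intro x hx w
  have key : wordAct f w x ∈ Z ∪ safeSet f U := by
    induction w with
    | nil => exact Or.inl hx
    | cons i w ih =>
      rcases ih with ih | ih
      · exact h _ ih i
      · exact Or.inr (mapsTo_safeSet f U i ih)
  exact key.elim (fun h => hU h) (fun h => safeSet_subset f U h)

end Words

/-! ### Stability of orbit closures: the topological part -/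

section Topological

variable {s : ℕ} {M : Type*} [TopologicalSpace M]

/-- `p` has arbitrarily small neighbourhoods mapped into themselves. -/
def IsTrapped (g : M → M) (p : M) : Prop :=
  ∀ O ∈ 𝓝 p, ∃ N, IsOpen N ∧ p ∈ N ∧ N ⊆ O ∧ MapsTo g N N

theorem mapsTo_closure_semigroupOrbit {f : Fin s → M → M} (hf : ∀ i, Continuous (f i)) (a : M)
    (i : Fin s) :
    MapsTo (f i) (closure (semigroupOrbit f a)) (closure (semigroupOrbit f a)) :=
  (mapsTo_semigroupOrbit f a i).closure (hf i)

/-- Compactness of the sequence space and of `K` (tube lemma) replaces a neighbourhood of the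
product by one of the form `univ ×ˢ v`. The safe set of `v` is then forward invariant and supplies
the smaller neighbourhood. -/
theorem isFiberLyapunovStable_of_safeSet {f : Fin s → M → M} {K : Set M} (hK : IsCompact K)
    (hcl : IsClosed K) (hinv : ∀ i, MapsTo (f i) K K)
    (h : ∀ U, IsOpen U → K ⊆ U → K ⊆ interior (safeSet f U)) : IsFiberLyapunovStable f K := by
  refine ⟨isClosed_univ.prod hcl, fun x hx => ⟨mem_univ _, hinv _ hx.2⟩, fun U' hU' => ?_⟩
  obtain ⟨O, hO, hKO, hOU⟩ := mem_nhdsSet_iff_exists.1 hU'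
  obtain ⟨u, v, -, hv, hu, hKv, huv⟩ :=
    generalized_tube_lemma (isCompact_univ (X := ℤ → Fin s)) hK hO hKO
  have hsub : (univ : Set (ℤ → Fin s)) ×ˢ safeSet f v ⊆ U' := fun x hx =>
    hOU (huv ⟨hu hx.1, safeSet_subset f v hx.2⟩)
  refine ⟨univ ×ˢ safeSet f v, ?_, hsub, fun x hx n => hsub ⟨mem_univ _, ?_⟩⟩
  · refine mem_nhdsSet_iff_exists.2 ⟨univ ×ˢ interior (safeSet f v), isOpen_univ.prod
      isOpen_interior, prod_mono_right (h v hv hKv), prod_mono_right interior_subset⟩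
  · exact iterate_fst_snd_stepSkewProduct_mem (mapsTo_safeSet f v) n x hx.2

/-- If all trajectories of a trapped periodic point leave its orbit through the interior of the
safe set, it is itself interior to the safe set. -/
theorem IsTrapped.mem_interior_safeSet {f : Fin s → M ≃ₜ M} {i₀ : Fin s} {U : Set M}
    (hU : IsOpen U) {p : M} {q : ℕ} (hq : 0 < q) (hp : IsTrapped ((f i₀)^[q]) p)
    (hpU : ∀ k, (f i₀)^[k] p ∈ U)
    (hpO : ∀ k, ∀ i ≠ i₀, f i ((f i₀)^[k] p) ∈ interior (safeSet (fun i => f i) U)) :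
    p ∈ interior (safeSet (fun i => f i) U) := by
  set O := interior (safeSet (fun i => (f i : M → M)) U) with hO
  -- Points of `U` that every generator other than `f i₀` sends into `O`. A point whose whole `f
  -- i₀`-trajectory stays in `Q` is safe.
  set Q : Set M := U ∩ ⋂ i : Fin s, {x | i ≠ i₀ → f i x ∈ O} with hQ
  have hQo : IsOpen Q := by
    refine hU.inter (isOpen_iInter_of_finite fun i => ?_)
    by_cases hi : i = i₀
    · simp [hi]
    · simp only [ne_eq, hi, not_false_eq_true, forall_const]
      exact isOpen_interior.preimage (f i).continuous
  have hpQ : ∀ k, (f i₀)^[k] p ∈ Q := fun k =>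
    ⟨hpU k, mem_iInter.2 fun i hi => hpO k i hi⟩
  have hnb : (⋂ k : Fin q, (f i₀)^[k] ⁻¹' Q) ∈ 𝓝 p :=
    (isOpen_iInter_of_finite fun k : Fin q =>
      hQo.preimage ((f i₀).continuous.iterate k)).mem_nhds (mem_iInter.2 fun k => hpQ k)
  obtain ⟨N, hNo, hpN, hNQ, hN⟩ := hp _ hnb
  -- Control of the first `q` iterates on `N` suffices: divide `k` by `q` and use that `N` is
  -- invariant under the `q`-th iterate.
  have hNZ : N ⊆ {x | ∀ k, (f i₀)^[k] x ∈ Q} := by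
    intro x hx k
    have h1 : ((f i₀)^[q])^[k / q] x ∈ N := hN.iterate (k / q) hx
    rw [← Function.iterate_mul] at h1
    have h2 := mem_iInter.1 (hNQ h1) ⟨k % q, Nat.mod_lt _ hq⟩
    rw [mem_preimage, ← Function.iterate_add_apply] at h2
    rwa [Nat.mod_add_div] at h2
  have hZ : {x | ∀ k, (f i₀)^[k] x ∈ Q} ⊆ safeSet (fun i => (f i : M → M)) U := by
    refine subset_safeSet (fun x hx => (hx 0).1) fun x hx i => ?_
    by_cases hi : i = i₀
    · left
      intro k
      subst hi
      exact hx (k + 1)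
    · exact Or.inr (interior_subset (mem_iInter.1 (hx 0).2 i hi))
  exact mem_interior.2 ⟨N, hNZ.trans hZ, hNo, hpN⟩

/-- A criterion for the orbit closure of an attracting periodic point of `f i₀` to lie in the
interior of the safe set, in terms of the points which arise by applying a generator other than
`f i₀` last. -/
theorem closure_semigroupOrbit_subset_interior_safeSet [T1Space M]
    (f : Fin s → M ≃ₜ M) (i₀ : Fin s)
    {a : M} (ha : a ∈ Function.periodicPts (f i₀))
    (hatt : ∃ q, 0 < q ∧ IsTrapped ((f i₀)^[q]) a) {U : Set M} (hU : IsOpen U)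
    (hKU : closure (semigroupOrbit (fun i => (f i : M → M)) a) ⊆ U)
    (hB : closure {y | ∃ i, i ≠ i₀ ∧ ∃ w, y = f i (wordAct (fun i => f i) w a)} ⊆
      interior (safeSet (fun i => f i) U))
    (hper : ∀ C : Set M, IsClosed C → C.Nonempty → MapsTo (f i₀) C C →
      ∃ p ∈ C, p ∈ Function.periodicPts (f i₀))
    (hhyp : ∀ p ∈ Function.periodicPts (f i₀), ∃ q, 0 < q ∧ (f i₀)^[q] p = p ∧
      (IsTrapped ((f i₀)^[q]) p ∨ IsTrapped ((f i₀).symm^[q]) p)) :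
    closure (semigroupOrbit (fun i => (f i : M → M)) a) ⊆
      interior (safeSet (fun i => f i) U) := by
  set F : Fin s → M → M := fun i => f i with hF
  set K := closure (semigroupOrbit F a) with hK
  set O := interior (safeSet F U) with hO
  set B := closure {y | ∃ i, i ≠ i₀ ∧ ∃ w, y = f i (wordAct F w a)} with hBdef
  have hFc : ∀ i, Continuous (F i) := fun i => (f i).continuous
  have hKinv : ∀ i, MapsTo (F i) K K := mapsTo_closure_semigroupOrbit hFc a
  have hKinv' : ∀ y ∈ K, ∀ k, (f i₀)^[k] y ∈ K := fun y hy k => (hKinv i₀).iterate k hy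
  have hKB : ∀ y ∈ K, ∀ i ≠ i₀, f i y ∈ B := by
    intro y hy i hi
    refine map_mem_closure (hFc i) hy ?_
    intro z hz
    obtain ⟨w, -, rfl⟩ := (mem_semigroupOrbit_iff F a z).1 hz
    exact ⟨i, hi, w, rfl⟩
  have haK : a ∈ K := subset_closure (self_mem_semigroupOrbit F ha)
  have hatt' : ∀ p ∈ K, ∀ q, 0 < q → IsTrapped ((f i₀)^[q]) p → p ∈ O := by
    intro p hp q hq hpt
    exact hpt.mem_interior_safeSet hU hq (fun k => hKU (hKinv' p hp k))
      fun k i hi => hB (hKB _ (hKinv' p hp k) i hi)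
  have haO : a ∈ O := by
    obtain ⟨q, hq, h⟩ := hatt
    exact hatt' a haK q hq h
  by_contra hcon
  -- The other generators send `K` into `B ⊆ O`. So if also `f i₀ y ∈ O`, then all images of points
  -- near `y` are safe, and `y ∈ O`.
  have hCinv : MapsTo (f i₀) (K \ O) (K \ O) := by
    rintro y ⟨hyK, hyO⟩
    refine ⟨hKinv i₀ hyK, fun hfy => hyO ?_⟩
    refine mem_interior.2 ⟨U ∩ ⋂ i, f i ⁻¹' O, ?_, hU.inter (isOpen_iInter_of_finite fun i =>
      isOpen_interior.preimage (f i).continuous), hKU hyK, mem_iInter.2 fun i => ?_⟩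
    · exact subset_safeSet inter_subset_left fun x hx i =>
        Or.inr (interior_subset (mem_iInter.1 hx.2 i))
    · by_cases hi : i = i₀
      · rw [hi]
        exact hfy
      · exact hB (hKB y hyK i hi)
  obtain ⟨p, ⟨hpK, hpO⟩, hpp⟩ := hper (K \ O) (isClosed_closure.sdiff isOpen_interior)
    (sdiff_nonempty.2 hcon) hCinv
  obtain ⟨q, hq, hqp, htr | htr⟩ := hhyp p hpp
  · exact hpO (hatt' p hpK q hq htr)
  have hsymm : ∀ k x, (f i₀).symm^[k] ((f i₀)^[k] x) = x := fun k =>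
    (show Function.LeftInverse (f i₀).symm (f i₀) from (f i₀).symm_apply_apply).iterate k
  -- By periodicity backward iterates of `p` are forward iterates, so they remain in `K \ O`, which
  -- misses both `B` and `a`.
  have hback : ∀ k : Fin q, (f i₀).symm^[k] p ∈ (B ∪ {a})ᶜ := by
    intro k
    have h1 : (f i₀).symm^[k] p = (f i₀)^[q - k] p := by
      rw [← hsymm k ((f i₀)^[q - k] p), ← Function.iterate_add_apply,
        Nat.add_sub_cancel' k.2.le, hqp]
    have h2 : (f i₀)^[q - k] p ∈ K \ O := hCinv.iterate (q - k) ⟨hpK, hpO⟩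
    rw [h1]
    rintro (h | h)
    · exact h2.2 (hB h)
    · rw [mem_singleton_iff] at h
      exact h2.2 (h ▸ haO)
  have hBo : ∀ k : Fin q, (f i₀).symm^[k] ⁻¹' (B ∪ {a})ᶜ ∈ 𝓝 p := by
    intro k
    have hcl : IsClosed (B ∪ {a}) := isClosed_closure.union isClosed_singleton
    exact (hcl.isOpen_compl.preimage ((f i₀).symm.continuous.iterate k)).mem_nhds (hback k)
  obtain ⟨N, hNo, hpN, hNM, hN⟩ := htr _ (Filter.iInter_mem.2 hBo)
  -- A neighbourhood of the repelling point `p` that `f i₀` cannot enter from outside: `N` is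
  -- invariant under the `q`-th iterate of the inverse, and the union over `k < q` makes this hold
  -- for a single step.
  set N' : Set M := ⋃ k : Fin q, (f i₀)^[k] ⁻¹' N with hN'
  have hN'o : IsOpen N' := isOpen_iUnion fun k => hNo.preimage ((f i₀).continuous.iterate k)
  have hpN' : p ∈ N' := mem_iUnion.2 ⟨⟨0, hq⟩, hpN⟩
  have hdis : ∀ x ∈ N', x ∉ B ∪ {a} := by
    intro x hx
    obtain ⟨k, hk⟩ := mem_iUnion.1 hx
    have := mem_iInter.1 (hNM hk) k
    rwa [mem_preimage, hsymm] at this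
  have hpre : ∀ x, f i₀ x ∈ N' → x ∈ N' := by
    intro x hx
    obtain ⟨k, hk⟩ := mem_iUnion.1 hx
    rw [mem_preimage, ← Function.iterate_succ_apply] at hk
    rcases Nat.lt_or_ge (k + 1) q with h | h
    · exact mem_iUnion.2 ⟨⟨k + 1, h⟩, hk⟩
    · have hkq : (k : ℕ).succ = q := le_antisymm k.2 h
      rw [hkq] at hk
      have := hN hk
      rw [hsymm] at this
      exact mem_iUnion.2 ⟨⟨0, hq⟩, this⟩
  have horb : ∀ w, wordAct F w a ∉ N' := by
    intro w
    induction w with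
    | nil => exact fun h => hdis a h (Or.inr rfl)
    | cons i w ih =>
      intro h
      rw [wordAct_cons] at h
      by_cases hi : i = i₀
      · subst hi
        exact ih (hpre _ h)
      · exact hdis _ h (Or.inl (subset_closure ⟨i, hi, w, rfl⟩))
  have hKN : K ⊆ N'ᶜ := by
    refine closure_minimal ?_ hN'o.isClosed_compl
    intro y hy
    obtain ⟨w, -, rfl⟩ := (mem_semigroupOrbit_iff F a y).1 hy
    exact horb w
  exact hKN hpK hpN'

end Topological

/-! ### Periodic points of circle maps in terms of lifts -/

section CircleMaps

/-- Close to an attracting fixed point of a lift, the iterates of a circle map contract. -/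
theorem exists_contracting_radius {Φ : ℝ → ℝ} {P c : ℝ} (hP : Φ P = P) (hd : HasDerivAt Φ c P)
    (hc : |c| < 1) : ∃ k, 0 ≤ k ∧ k < 1 ∧ ∃ δ > 0, ∀ x, |x - P| < δ → |Φ x - P| ≤ k * |x - P| := by
  obtain ⟨k, hck, hk⟩ := exists_between hc
  refine ⟨k, (abs_nonneg c).trans hck.le, hk, ?_⟩
  have h1 := hd.isLittleO.def (sub_pos.2 hck)
  obtain ⟨δ, hδ, h2⟩ := Metric.eventually_nhds_iff.1 h1
  refine ⟨δ, hδ, fun x hx => ?_⟩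
  have h3 := h2 (show dist x P < δ from hx)
  simp only [hP, smul_eq_mul, Real.norm_eq_abs] at h3
  calc |Φ x - P| = |(Φ x - P - (x - P) * c) + (x - P) * c| := by ring_nf
    _ ≤ |Φ x - P - (x - P) * c| + |(x - P) * c| := abs_add_le _ _
    _ ≤ (k - |c|) * |x - P| + |x - P| * |c| := by rw [abs_mul]; gcongr
    _ = k * |x - P| := by ring

theorem isOpen_coe_image_ball (P δ : ℝ) :
    IsOpen ((fun x : ℝ => (x : UnitAddCircle)) '' Metric.ball P δ) :=
  QuotientAddGroup.isOpenMap_coe _ Metric.isOpen_ball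

theorem exists_coe_image_ball_subset {P : ℝ} {O : Set UnitAddCircle}
    (hO : O ∈ 𝓝 (P : UnitAddCircle)) :
    ∃ δ > 0, (fun x : ℝ => (x : UnitAddCircle)) '' Metric.ball P δ ⊆ O := by
  have h : (fun x : ℝ => (x : UnitAddCircle)) ⁻¹' O ∈ 𝓝 P :=
    (AddCircle.continuous_mk' (1 : ℝ)).continuousAt.preimage_mem_nhds hO
  obtain ⟨δ, hδ, h⟩ := Metric.mem_nhds_iff.1 h
  exact ⟨δ, hδ, image_subset_iff.2 h⟩

/-- Small balls around the fixed point are contracted by `Φ`, and their images on the circle are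
open. -/
theorem isTrapped_of_hasDerivAt {φ : UnitAddCircle → UnitAddCircle} {Φ : ℝ → ℝ}
    (hΦ : ∀ x : ℝ, (Φ x : UnitAddCircle) = φ x) {P c : ℝ} (hP : Φ P = P) (hd : HasDerivAt Φ c P)
    (hc : |c| < 1) : IsTrapped φ (P : UnitAddCircle) := by
  obtain ⟨k, hk0, hk1, δ, hδ, h⟩ := exists_contracting_radius hP hd hc
  intro O hO
  obtain ⟨ε, hε, hεO⟩ := exists_coe_image_ball_subset hO
  refine ⟨_, isOpen_coe_image_ball P (min δ ε), ⟨P, by simp [hδ, hε], rfl⟩,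
    (image_mono (Metric.ball_subset_ball (min_le_right _ _))).trans hεO, ?_⟩
  rintro _ ⟨x, hx, rfl⟩
  refine ⟨Φ x, ?_, hΦ x⟩
  rw [Metric.mem_ball, Real.dist_eq] at hx ⊢
  have h1 := h x (hx.trans_le (min_le_left _ _))
  nlinarith [abs_nonneg (x - P)]

/-- Every neighbourhood of an attracting fixed point is eventually reached by the iterates of a
fixed one. -/
theorem exists_nhds_mapsTo_iterate {φ : UnitAddCircle → UnitAddCircle} {Φ : ℝ → ℝ}
    (hΦ : ∀ x : ℝ, (Φ x : UnitAddCircle) = φ x) {P c : ℝ} (hP : Φ P = P) (hd : HasDerivAt Φ c P)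
    (hc : |c| < 1) : ∃ D ∈ 𝓝 (P : UnitAddCircle), ∀ O ∈ 𝓝 (P : UnitAddCircle),
      ∃ m, MapsTo φ^[m] D O := by
  obtain ⟨k, hk0, hk1, δ, hδ, h⟩ := exists_contracting_radius hP hd hc
  refine ⟨_, (isOpen_coe_image_ball P δ).mem_nhds ⟨P, by simp [hδ], rfl⟩, fun O hO => ?_⟩
  obtain ⟨ε, hε, hεO⟩ := exists_coe_image_ball_subset hO
  obtain ⟨m, hm⟩ := exists_pow_lt_of_lt_one (div_pos hε hδ) hk1
  refine ⟨m, ?_⟩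
  rintro _ ⟨x, hx, rfl⟩
  rw [Metric.mem_ball, Real.dist_eq] at hx
  have key : ∀ n, ((Φ^[n] x : ℝ) : UnitAddCircle) = φ^[n] x ∧ |Φ^[n] x - P| ≤ k ^ n * |x - P| := by
    intro n
    induction n with
    | zero => simp
    | succ n ih =>
      rw [Function.iterate_succ_apply', Function.iterate_succ_apply', hΦ, ih.1]
      have h1 : k ^ n * |x - P| ≤ |x - P| :=
        mul_le_of_le_one_left (abs_nonneg _) (pow_le_one₀ hk0 hk1.le)
      refine ⟨rfl, (h _ ((ih.2.trans h1).trans_lt hx)).trans ?_⟩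
      rw [pow_succ', mul_assoc]
      exact mul_le_mul_of_nonneg_left ih.2 hk0
  show φ^[m] x ∈ O
  rw [← (key m).1]
  refine hεO ⟨_, ?_, rfl⟩
  rw [Metric.mem_ball, Real.dist_eq]
  have h3 : k ^ m * δ < ε := (lt_div_iff₀ hδ).1 hm
  exact ((key m).2.trans (mul_le_mul_of_nonneg_left hx.le (pow_nonneg hk0 m))).trans_lt h3

theorem exists_int_eq_of_coe_eq {x y : ℝ} (h : (x : UnitAddCircle) = y) : ∃ n : ℤ, x = y + n := by
  have h1 : ((x - y : ℝ) : UnitAddCircle) = 0 := by rw [AddCircle.coe_sub, h, sub_self]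
  obtain ⟨n, hn⟩ := (AddCircle.coe_eq_zero_iff (1 : ℝ)).1 h1
  exact ⟨n, by simp only [zsmul_eq_mul, mul_one] at hn; linarith⟩

@[simp] theorem coe_add_intCast_circle (x : ℝ) (n : ℤ) :
    ((x + n : ℝ) : UnitAddCircle) = x := by
  have : ((n : ℝ) : UnitAddCircle) = 0 := (AddCircle.coe_eq_zero_iff (1 : ℝ)).2 ⟨n, by simp⟩
  rw [AddCircle.coe_add, this, add_zero]

theorem coe_iterate_lift {φ : UnitAddCircle → UnitAddCircle} {Φ : ℝ → ℝ}
    (hΦ : ∀ x : ℝ, (Φ x : UnitAddCircle) = φ x) (n : ℕ) (x : ℝ) :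
    ((Φ^[n] x : ℝ) : UnitAddCircle) = φ^[n] x :=
  Function.Semiconj.iterate_right (f := fun x : ℝ => (x : UnitAddCircle)) hΦ n x

end CircleMaps

/-! ### Periodic points, sinks and sources of circle diffeomorphisms. -/

namespace CircleDiffeo

variable {r : ℕ}

/-- The increment over a period is a positive integer `n` by monotonicity. If `n ≥ 2`, the lift
would take the value `f.lift 0 + 1` strictly between `0` and `1`, against injectivity on the circle.
-/
theorem lift_add_one (f : CircleDiffeo r) (x : ℝ) : f.lift (x + 1) = f.lift x + 1 := by
  have hc := f.contDiff_lift.continuous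
  obtain ⟨n, hn⟩ := f.lift_unique (fun x => f.lift (x + 1)) (hc.comp (continuous_add_const 1))
    fun x => by
      rw [coe_lift]
      congr 1
      simp
  have hpos : 0 < n := by
    have h1 := f.strictMono_lift (show (0 : ℝ) < 0 + 1 by norm_num)
    rw [hn 0] at h1
    exact_mod_cast (lt_add_iff_pos_right _).1 h1
  have hle : n ≤ 1 := by
    by_contra! h2
    have h3 : (2 : ℝ) ≤ n := by exact_mod_cast h2
    obtain ⟨z, hz, hzv⟩ := intermediate_value_Icc (show (0 : ℝ) ≤ 0 + 1 by norm_num)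
      hc.continuousOn (show f.lift 0 + 1 ∈ Icc (f.lift 0) (f.lift (0 + 1)) by
        rw [hn 0]; constructor <;> linarith)
    have h4 : (z : UnitAddCircle) = ((0 : ℝ) : UnitAddCircle) := by
      apply f.toHomeomorph.injective
      have h5 := f.coe_lift z
      have h6 := f.coe_lift 0
      have h7 := coe_add_intCast_circle (f.lift 0) 1
      rw [hzv] at h5
      rw [Int.cast_one] at h7
      exact h5.symm.trans (h7.trans h6)
    obtain ⟨m, hm⟩ := exists_int_eq_of_coe_eq h4
    rw [zero_add] at hm
    have h01 : m = 0 ∨ m = 1 := by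
      have h8 : (0 : ℝ) ≤ m := hm ▸ hz.1
      have h9 : (m : ℝ) ≤ 1 := by have := hz.2; rw [hm] at this; linarith
      have h8' : 0 ≤ m := by exact_mod_cast h8
      have h9' : m ≤ 1 := by exact_mod_cast h9
      omega
    rcases h01 with rfl | rfl
    · rw [hm, Int.cast_zero] at hzv
      linarith
    · have h10 := hn 0
      rw [hm, Int.cast_one] at hzv
      rw [zero_add] at h10
      linarith
  have : n = 1 := le_antisymm hle hpos
  rw [hn x, this, Int.cast_one]

theorem iterate_lift_add_int (f : CircleDiffeo r) (q : ℕ) (m : ℤ) (x : ℝ) :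
    f.lift^[q] (x + m) = f.lift^[q] x + m := by
  have h1 : ∀ x : ℝ, f.lift (x + m) = f.lift x + m := by
    intro x
    have hp : Function.Periodic (fun x => f.lift x - x) 1 := fun x => by
      simp only [lift_add_one]
      ring
    have := hp.int_mul m x
    simp only [mul_one] at this
    linarith
  induction q generalizing x with
  | zero => rfl
  | succ q ih => rw [Function.iterate_succ_apply, h1, ih, Function.iterate_succ_apply]

/-- If `f` has a periodic point, then so does every nonempty closed invariant set. -/
theorem exists_periodic_of_isClosed (f : CircleDiffeo r)
    (hper : (Function.periodicPts f).Nonempty) {C : Set UnitAddCircle} (hC : IsClosed C)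
    (hne : C.Nonempty) (hinv : MapsTo f C C) : ∃ p ∈ C, p ∈ Function.periodicPts f := by
  obtain ⟨p, q, hq, hp⟩ := hper
  obtain ⟨P, rfl⟩ := QuotientAddGroup.mk_surjective p
  obtain ⟨c, hc⟩ := hne
  obtain ⟨y, rfl⟩ := QuotientAddGroup.mk_surjective c
  obtain ⟨n, hn⟩ := exists_int_eq_of_coe_eq ((coe_iterate_lift f.coe_lift q P).trans hp)
  -- A monotone lift of `f^[q]` fixing every integer translate of `P`. The orbit of `y` under `H` is
  -- monotone and bounded by such translates, so it converges to a fixed point of `H`, whose image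
  -- lies in `C`.
  set H : ℝ → ℝ := fun x => f.lift^[q] x - n with hH
  have hHm : Monotone H := fun x z h =>
    sub_le_sub_right (f.strictMono_lift.monotone.iterate q h) _
  have hHc : Continuous H := (f.contDiff_lift.continuous.iterate q).sub continuous_const
  have hHi : ∀ m : ℤ, H (P + m) = P + m := fun m => by
    simp only [hH, iterate_lift_add_int, hn]
    ring
  have hHcoe : ∀ x : ℝ, (H x : UnitAddCircle) = f^[q] x := fun x => by
    have := coe_add_intCast_circle (f.lift^[q] x) (-n)
    rw [Int.cast_neg, ← sub_eq_add_neg] at this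
    exact this.trans (coe_iterate_lift f.coe_lift q x)
  have hlow : ∀ m : ℤ, P + m ≤ y → ∀ k, P + m ≤ H^[k] y := fun m h k => by
    have := hHm.iterate k h
    rwa [Function.iterate_fixed (hHi m)] at this
  have hupp : ∀ m : ℤ, y ≤ P + m → ∀ k, H^[k] y ≤ P + m := fun m h k => by
    have := hHm.iterate k h
    rwa [Function.iterate_fixed (hHi m)] at this
  obtain ⟨l, hl⟩ : ∃ l, Filter.Tendsto (fun k => H^[k] y) Filter.atTop (𝓝 l) := by
    rcases le_total y (H y) with h | h
    · refine ⟨_, tendsto_atTop_ciSup (hHm.monotone_iterate_of_le_map h)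
        ⟨P + ⌈y - P⌉, ?_⟩⟩
      rintro _ ⟨k, rfl⟩
      exact hupp _ (by linarith [Int.le_ceil (y - P)]) k
    · refine ⟨_, tendsto_atTop_ciInf (hHm.antitone_iterate_of_map_le h)
        ⟨P + ⌊y - P⌋, ?_⟩⟩
      rintro _ ⟨k, rfl⟩
      exact hlow _ (by linarith [Int.floor_le (y - P)]) k
  have hfix : H l = l := isFixedPt_of_tendsto_iterate hl hHc.continuousAt
  refine ⟨(l : UnitAddCircle), ?_, q, hq, ?_⟩
  · refine hC.mem_of_tendsto (((AddCircle.continuous_mk' (1 : ℝ)).tendsto l).comp hl)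
      (Filter.Eventually.of_forall fun k => ?_)
    show ((H^[k] y : ℝ) : UnitAddCircle) ∈ C
    rw [coe_iterate_lift hHcoe k y]
    exact (hinv.iterate q).iterate k hc
  · exact (hHcoe l).symm.trans (by rw [hfix])

/-- A lift of `f^p` near a point of least period `p` which fixes a representative. -/
theorem exists_lift_iterate_fixing (f : CircleDiffeo r) (hr : 1 ≤ r) (a : UnitAddCircle) :
    ∃ (Φ : ℝ → ℝ) (P : ℝ), (P : UnitAddCircle) = a ∧ Φ P = P ∧ Continuous Φ ∧
      (∀ x : ℝ, (Φ x : UnitAddCircle) = f^[Function.minimalPeriod f a] x) ∧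
      HasDerivAt Φ (f.multiplier a) P := by
  set q := Function.minimalPeriod f a with hq
  set P : ℝ := (AddCircle.equivIco (1 : ℝ) 0 a : ℝ) with hPdef
  have hP : (P : UnitAddCircle) = a := AddCircle.coe_equivIco
  have hfix : f^[q] a = a := Function.iterate_minimalPeriod
  obtain ⟨n, hn⟩ := exists_int_eq_of_coe_eq
    ((coe_iterate_lift f.coe_lift q P).trans (by rw [hP, hfix] : f^[q] P = (P : UnitAddCircle)))
  have hdiff : Differentiable ℝ (f.lift^[q]) :=
    (f.contDiff_lift.differentiable (by exact_mod_cast (Nat.one_le_iff_ne_zero.1 hr))).iterate q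
  refine ⟨fun x => f.lift^[q] x - n, P, hP, ?_, hdiff.continuous.sub continuous_const, ?_, ?_⟩
  · simp only [hn]
    ring
  · intro x
    have := coe_add_intCast_circle (f.lift^[q] x) (-n)
    rw [Int.cast_neg, ← sub_eq_add_neg] at this
    exact this.trans (coe_iterate_lift f.coe_lift q x)
  · exact (hdiff P).hasDerivAt.sub_const (n : ℝ)

theorem IsSink.isTrapped {f : CircleDiffeo r} (hr : 1 ≤ r) {a : UnitAddCircle} (ha : f.IsSink a) :
    IsTrapped (f^[Function.minimalPeriod f a]) a := by
  obtain ⟨Φ, P, hPa, hP, -, hΦ, hd⟩ := f.exists_lift_iterate_fixing hr a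
  exact hPa ▸ isTrapped_of_hasDerivAt hΦ hP hd ha.2

theorem IsSink.exists_nhds_mapsTo_iterate {f : CircleDiffeo r} (hr : 1 ≤ r) {a : UnitAddCircle}
    (ha : f.IsSink a) : ∃ D ∈ 𝓝 a, ∀ O ∈ 𝓝 a, ∃ m, MapsTo f^[m] D O := by
  obtain ⟨Φ, P, hPa, hP, -, hΦ, hd⟩ := f.exists_lift_iterate_fixing hr a
  obtain ⟨D, hD, h⟩ := _root_.exists_nhds_mapsTo_iterate hΦ hP hd ha.2
  rw [hPa] at hD h
  refine ⟨D, hD, fun O hO => ?_⟩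
  obtain ⟨m, hm⟩ := h O hO
  exact ⟨_ * m, by rwa [Function.iterate_mul]⟩

/-- The inverse has multiplier `(f.multiplier a)⁻¹` at `a`, so the attracting case applies to it. -/
theorem isTrapped_symm_of_one_lt (f : CircleDiffeo r) (hr : 1 ≤ r) {a : UnitAddCircle}
    (h : 1 < |f.multiplier a|) :
    IsTrapped (f.toHomeomorph.symm^[Function.minimalPeriod f a]) a := by
  obtain ⟨Φ, P, hPa, hP, hΦc, hΦ, hd⟩ := f.exists_lift_iterate_fixing hr a
  set q := Function.minimalPeriod f a with hq
  obtain ⟨G, hG, hGcoe⟩ := f.exists_lift_symm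
  have hGcoe' : ∀ x : ℝ, (G x : UnitAddCircle) = f.toHomeomorph.symm x := hGcoe
  have hinv : ∀ x, f^[q] (f.toHomeomorph.symm^[q] x) = x :=
    (show Function.LeftInverse f f.toHomeomorph.symm from
      f.toHomeomorph.apply_symm_apply).iterate q
  have hinv' : ∀ x, f.toHomeomorph.symm^[q] (f^[q] x) = x :=
    (show Function.LeftInverse f.toHomeomorph.symm f from
      f.toHomeomorph.symm_apply_apply).iterate q
  have hfix : f^[q] a = a := Function.iterate_minimalPeriod
  have hfix' : f.toHomeomorph.symm^[q] a = a := by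
    conv_lhs => rw [← hfix]
    exact hinv' a
  obtain ⟨n, hn⟩ := exists_int_eq_of_coe_eq
    ((coe_iterate_lift hGcoe' q P).trans
      (by rw [hPa, hfix'] : f.toHomeomorph.symm^[q] P = (P : UnitAddCircle)))
  set Ψ : ℝ → ℝ := fun x => G^[q] x - n with hΨ
  have hΨP : Ψ P = P := by
    simp only [hΨ, hn]
    ring
  have hΨc : Continuous Ψ := (hG.continuous.iterate q).sub continuous_const
  have hΨcoe : ∀ x : ℝ, (Ψ x : UnitAddCircle) = f.toHomeomorph.symm^[q] x := fun x => by
    have := coe_add_intCast_circle (G^[q] x) (-n)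
    rw [Int.cast_neg, ← sub_eq_add_neg] at this
    exact this.trans (coe_iterate_lift hGcoe' q x)
  -- The difference `Φ (Ψ x) - x` is an integer, is continuous in `x`, and vanishes at `P`.
  have hloc : ∀ᶠ x in 𝓝 P, Φ (Ψ x) = x := by
    have hc : Continuous fun x => Φ (Ψ x) - x := (hΦc.comp hΨc).sub continuous_id
    have h0 : Φ (Ψ P) - P = 0 := by rw [hΨP, hP, sub_self]
    have h1 : ∀ᶠ x in 𝓝 P, |Φ (Ψ x) - x| < 1 :=
      hc.abs.continuousAt.eventually_lt continuousAt_const (by simp [h0])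
    filter_upwards [h1] with x hx
    obtain ⟨m, hm⟩ := exists_int_eq_of_coe_eq
      (show ((Φ (Ψ x) : ℝ) : UnitAddCircle) = x by rw [hΦ, hΨcoe, hinv])
    rw [hm, add_sub_cancel_left] at hx
    have : |m| < 1 := by exact_mod_cast hx
    rw [hm, Int.abs_lt_one_iff.1 this, Int.cast_zero, add_zero]
  have hdΨ : HasDerivAt Ψ (f.multiplier a)⁻¹ P := by
    refine HasDerivAt.of_local_left_inverse hΨc.continuousAt (by rwa [hΨP]) ?_ hloc
    intro h0
    rw [h0, abs_zero] at h
    linarith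
  rw [← hPa]
  exact isTrapped_of_hasDerivAt hΨcoe hΨP hdΨ (by rw [abs_inv]; exact inv_lt_one_of_one_lt₀ h)

end CircleDiffeo

/-! ### Perturbation by rotations -/

section Shift

variable {s : ℕ}

/-- Add the constant `t` to all the maps except the map number `i₀`. -/
def shiftLifts (i₀ : Fin s) (L : Fin s → ℝ → ℝ) (t : ℝ) : Fin s → ℝ → ℝ :=
  fun i x => if i = i₀ then L i x else L i x + t

theorem shiftLifts_zero (i₀ : Fin s) (L : Fin s → ℝ → ℝ) : shiftLifts i₀ L 0 = L := by
  ext i x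
  simp [shiftLifts]

theorem continuous_wordAct_shiftLifts (i₀ : Fin s) {L : Fin s → ℝ → ℝ}
    (hL : ∀ i, Continuous (L i)) (w : List (Fin s)) (x : ℝ) :
    Continuous fun t => wordAct (shiftLifts i₀ L t) w x := by
  induction w with
  | nil => exact continuous_const
  | cons i w ih =>
    simp only [wordAct_cons, shiftLifts]
    split_ifs
    · exact (hL i).comp ih
    · exact ((hL i).comp ih).add continuous_id

theorem wordAct_shiftLifts_mono (i₀ : Fin s) {L : Fin s → ℝ → ℝ} (hL : ∀ i, Monotone (L i))
    (w : List (Fin s)) {t t' x x' : ℝ} (ht : t ≤ t') (hx : x ≤ x') :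
    wordAct (shiftLifts i₀ L t) w x ≤ wordAct (shiftLifts i₀ L t') w x' := by
  induction w with
  | nil => exact hx
  | cons i w ih =>
    simp only [wordAct_cons, shiftLifts]
    split_ifs
    · exact hL i ih
    · exact add_le_add (hL i ih) ht

/-- Every image of a point `δ`-close to a point of an orbit, which is reached by applying a map
other than the map number `i₀`, belongs to the orbit of a system shifted by at most `δ`. -/
theorem exists_shiftLifts_eq (i₀ : Fin s) {L : Fin s → ℝ → ℝ} (hc : ∀ i, Continuous (L i))
    (hL : ∀ i, Monotone (L i)) {i : Fin s} (hi : i ≠ i₀) (w v : List (Fin s)) (x δ : ℝ) :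
    ∃ t, |t| ≤ |δ| ∧
      wordAct (shiftLifts i₀ L t) (w ++ i :: v) x = wordAct L w (wordAct L (i :: v) x + δ) := by
  -- The target lies between the orbit points for shifts `0` and `δ`: the shift `δ` acts at the
  -- letter `i`, and its effect at all other letters has the same sign by monotonicity.
  have hmem : wordAct L w (wordAct L (i :: v) x + δ) ∈
      uIcc (wordAct (shiftLifts i₀ L 0) (w ++ i :: v) x)
        (wordAct (shiftLifts i₀ L δ) (w ++ i :: v) x) := by
    have hLz : ∀ w x, wordAct L w x = wordAct (shiftLifts i₀ L 0) w x := fun w x => by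
      rw [shiftLifts_zero]
    have hδ : ∀ y, wordAct (shiftLifts i₀ L δ) (i :: v) y
        = L i (wordAct (shiftLifts i₀ L δ) v y) + δ := fun y => by
      simp [shiftLifts, hi]
    rcases le_total 0 δ with h | h
    · rw [mem_uIcc]
      left
      rw [wordAct_append, wordAct_append, hδ, hLz w, hLz (i :: v)]
      refine ⟨wordAct_shiftLifts_mono i₀ hL w le_rfl (le_add_of_nonneg_right h),
        wordAct_shiftLifts_mono i₀ hL w h (add_le_add ?_ le_rfl)⟩
      rw [← hLz]
      refine hL i ?_
      show wordAct L v x ≤ _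
      rw [hLz v]
      exact wordAct_shiftLifts_mono i₀ hL v h le_rfl
    · rw [mem_uIcc]
      right
      rw [wordAct_append, wordAct_append, hδ, hLz w, hLz (i :: v)]
      refine ⟨wordAct_shiftLifts_mono i₀ hL w h (add_le_add ?_ le_rfl),
        wordAct_shiftLifts_mono i₀ hL w le_rfl (add_le_of_nonpos_right h)⟩
      rw [← hLz]
      refine hL i ?_
      show _ ≤ wordAct L v x
      rw [hLz v]
      exact wordAct_shiftLifts_mono i₀ hL v h le_rfl
  obtain ⟨t, ht, h⟩ := intermediate_value_uIcc
    (continuous_wordAct_shiftLifts i₀ hc (w ++ i :: v) x).continuousOn hmem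
  refine ⟨t, ?_, h⟩
  simpa using abs_sub_left_of_mem_uIcc ht

theorem coe_wordAct {L : Fin s → ℝ → ℝ} {f : Fin s → UnitAddCircle → UnitAddCircle}
    (h : ∀ i (x : ℝ), (L i x : UnitAddCircle) = f i x) (w : List (Fin s)) (x : ℝ) :
    ((wordAct L w x : ℝ) : UnitAddCircle) = wordAct f w x := by
  induction w with
  | nil => rfl
  | cons i w ih => rw [wordAct_cons, wordAct_cons, h, ih]

end Shift

namespace CircleDiffeo

variable {r s : ℕ}

/-- The composition of a circle diffeomorphism with the rotation by `t`. -/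
def rotate (f : CircleDiffeo r) (t : ℝ) : CircleDiffeo r where
  toHomeomorph := f.toHomeomorph.trans (Homeomorph.addRight (t : UnitAddCircle))
  exists_lift := by
    refine ⟨fun x => f.lift x + t, f.contDiff_lift.add contDiff_const,
      f.strictMono_lift.add_const t, fun x => ?_⟩
    rw [AddCircle.coe_add, coe_lift]
    rfl
  exists_lift_symm := by
    obtain ⟨G, hG, h⟩ := f.exists_lift_symm
    refine ⟨fun x => G (x - t), hG.comp (contDiff_id.sub contDiff_const), fun x => ?_⟩
    rw [h, AddCircle.coe_sub, sub_eq_add_neg]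
    rfl

theorem rotate_apply (f : CircleDiffeo r) (t : ℝ) (x : UnitAddCircle) :
    f.rotate t x = f x + (t : UnitAddCircle) := rfl

theorem iteratedDeriv_lift_rotate (f : CircleDiffeo r) (t : ℝ) (k : ℕ) :
    iteratedDeriv (k + 1) (f.rotate t).lift = iteratedDeriv (k + 1) f.lift := by
  obtain ⟨n, hn⟩ := (f.rotate t).lift_unique (fun x => f.lift x + t)
    (f.contDiff_lift.continuous.add continuous_const) fun x => by
      rw [AddCircle.coe_add, coe_lift, rotate_apply]
  have h : (f.rotate t).lift = fun x => f.lift x + (t - n) := by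
    ext x
    have := hn x
    linarith
  rw [h, iteratedDeriv_succ', iteratedDeriv_succ']
  congr 1
  ext x
  simp

/-- A rotation does not change the derivatives of order at least one, so only uniform convergence of
the maps is at stake. -/
theorem tendsto_rotate (f : CircleDiffeo r) :
    Filter.Tendsto (fun t : ℝ => f.rotate t) (𝓝 0) (𝓝 f) := by
  rw [nhds_induced, Filter.tendsto_comap_iff, nhds_prod_eq]
  refine Filter.Tendsto.prodMk ?_ ?_
  · refine UniformFun.tendsto_iff_tendstoUniformly.2 (Metric.tendstoUniformly_iff.2 fun ε hε => ?_)
    have h : Filter.Tendsto (fun t : ℝ => (t : UnitAddCircle)) (𝓝 0) (𝓝 0) := by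
      have := (AddCircle.continuous_mk' (1 : ℝ)).tendsto 0
      rwa [map_zero] at this
    filter_upwards [Metric.tendsto_nhds.1 h ε hε] with t ht x
    show dist (f x) (f x + (t : UnitAddCircle)) < ε
    rw [dist_comm, dist_eq_norm, add_sub_cancel_left]
    rwa [dist_eq_norm, sub_zero] at ht
  · rw [tendsto_pi_nhds]
    intro k
    simp only [iteratedDeriv_lift_rotate]
    exact tendsto_const_nhds

/-- Rotate all the maps except the map number `i₀`. -/
def twist (i₀ : Fin s) (f : Fin s → CircleDiffeo r) (t : ℝ) : Fin s → CircleDiffeo r :=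
  fun i => if i = i₀ then f i else (f i).rotate t

theorem twist_self (i₀ : Fin s) (f : Fin s → CircleDiffeo r) (t : ℝ) : twist i₀ f t i₀ = f i₀ :=
  if_pos rfl

theorem tendsto_twist (i₀ : Fin s) (f : Fin s → CircleDiffeo r) :
    Filter.Tendsto (twist i₀ f) (𝓝 0) (𝓝 f) := by
  rw [tendsto_pi_nhds]
  intro i
  by_cases hi : i = i₀
  · simp only [twist, hi, if_true]
    exact tendsto_const_nhds
  · simp only [twist, hi, if_false]
    exact (f i).tendsto_rotate

theorem coe_shiftLifts (i₀ : Fin s) (f : Fin s → CircleDiffeo r) (t : ℝ) (i : Fin s) (x : ℝ) :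
    ((shiftLifts i₀ (fun i => (f i).lift) t i x : ℝ) : UnitAddCircle) = twist i₀ f t i x := by
  by_cases hi : i = i₀
  · simp [shiftLifts, twist, hi, coe_lift]
  · simp [shiftLifts, twist, hi, coe_lift, rotate_apply]

/-- The action of a word of circle diffeomorphisms. -/
abbrev act (f : Fin s → CircleDiffeo r) (w : List (Fin s)) (x : UnitAddCircle) : UnitAddCircle :=
  wordAct (fun i => (f i : UnitAddCircle → UnitAddCircle)) w x

/-- If the orbits of `a` under small twists avoid `V`, then the trajectories of all points close
to those obtained from `a` by applying a map other than the map number `i₀` last avoid `V`. -/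
theorem subset_interior_safeSet_of_twist (i₀ : Fin s) (f : Fin s → CircleDiffeo r)
    (a : UnitAddCircle) (V : Set UnitAddCircle)
    (hV : ∀ᶠ t in 𝓝 (0 : ℝ), ∀ w ≠ [], act (twist i₀ f t) w a ∉ V) :
    closure {y | ∃ i, i ≠ i₀ ∧ ∃ w, y = f i (act f w a)} ⊆
      interior (safeSet (fun i => (f i : UnitAddCircle → UnitAddCircle)) Vᶜ) := by
  obtain ⟨ε, hε, hV⟩ := Metric.eventually_nhds_iff.1 hV
  intro y hy
  refine mem_interior.2 ⟨Metric.ball y (ε / 2), ?_, Metric.isOpen_ball,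
    Metric.mem_ball_self (half_pos hε)⟩
  intro x hx w hxV
  obtain ⟨z, ⟨i, hi, v, rfl⟩, hz⟩ := Metric.mem_closure_iff.1 hy (ε / 2) (half_pos hε)
  have hdist : ‖x - f i (act f v a)‖ < ε := by
    rw [← dist_eq_norm]
    have := dist_triangle x y (f i (act f v a))
    rw [Metric.mem_ball] at hx
    linarith
  obtain ⟨A, rfl⟩ := QuotientAddGroup.mk_surjective a
  -- Subtracting the nearest integer gives a real representative whose absolute value is the circle
  -- norm.
  obtain ⟨δ, hδ, hδε⟩ : ∃ δ : ℝ, (δ : UnitAddCircle) = x - f i (act f v A) ∧ |δ| < ε := by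
    obtain ⟨D, hD⟩ := QuotientAddGroup.mk_surjective (x - f i (act f v A))
    refine ⟨D - round D, ?_, ?_⟩
    · have := coe_add_intCast_circle D (-round D)
      rw [Int.cast_neg, ← sub_eq_add_neg] at this
      exact this.trans hD
    · rw [← UnitAddCircle.norm_eq]
      exact hD ▸ hdist
  obtain ⟨t, ht, h⟩ := exists_shiftLifts_eq i₀ (L := fun i => (f i).lift)
    (fun i => (f i).contDiff_lift.continuous) (fun i => (f i).strictMono_lift.monotone) hi w v A δ
  refine hV (y := t) (by simpa using ht.trans_lt hδε) (w ++ i :: v) (by simp) ?_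
  have h1 := congrArg (fun x : ℝ => (x : UnitAddCircle)) h
  simp only [coe_wordAct (coe_shiftLifts i₀ f t)] at h1
  have h2 : ∀ w (x : ℝ), ((wordAct (fun i => (f i).lift) w x : ℝ) : UnitAddCircle)
      = act f w x := coe_wordAct fun i => (f i).coe_lift
  rw [h2, AddCircle.coe_add, h2, hδ] at h1
  simp only [act, wordAct_cons, add_sub_cancel] at h1
  rw [act, h1]
  exact hxV

/-! ### Generic systems -/

theorem continuous_toContinuousMap :
    Continuous fun f : CircleDiffeo r => (f.toHomeomorph : C(UnitAddCircle, UnitAddCircle)) := by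
  rw [continuous_iff_continuousAt]
  intro f
  refine ContinuousMap.tendsto_iff_tendstoUniformly.2 ?_
  have h : Continuous fun f : CircleDiffeo r =>
      (UniformFun.ofFun (f : UnitAddCircle → UnitAddCircle) :
        UniformFun UnitAddCircle UnitAddCircle) :=
    continuous_fst.comp (continuous_induced_dom (f := fun f : CircleDiffeo r =>
      ((UniformFun.ofFun (f : UnitAddCircle → UnitAddCircle) :
          UniformFun UnitAddCircle UnitAddCircle),
        fun k : Fin r => (UniformFun.ofFun (iteratedDeriv (k + 1) f.lift) : UniformFun ℝ ℝ))))
  exact UniformFun.tendsto_iff_tendstoUniformly.1 (h.tendsto f)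

/-- The action of a word depends continuously on the system in the compact-open topology, because
composition is continuous there. -/
theorem isOpen_setOf_mapsTo_act (w : List (Fin s)) {J V : Set UnitAddCircle} (hJ : IsCompact J)
    (hV : IsOpen V) : IsOpen {f : Fin s → CircleDiffeo r | MapsTo (act f w) J V} := by
  obtain ⟨Φ, hΦ, h⟩ : ∃ Φ : (Fin s → CircleDiffeo r) → C(UnitAddCircle, UnitAddCircle),
      Continuous Φ ∧ ∀ f x, Φ f x = act f w x := by
    induction w with
    | nil => exact ⟨fun _ => ContinuousMap.id _, continuous_const, fun _ _ => rfl⟩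
    | cons i w ih =>
      obtain ⟨Φ, hΦ, h⟩ := ih
      refine ⟨fun f => ((f i).toHomeomorph : C(UnitAddCircle, UnitAddCircle)).comp (Φ f),
        (continuous_toContinuousMap.comp (continuous_apply i)).compCM hΦ, fun f x => ?_⟩
      rw [act, wordAct_cons, ← act, ← h]
      rfl
  have := (ContinuousMap.isOpen_setOfPred_mapsTo hJ hV).preimage hΦ
  convert this using 1
  ext f
  simp only [mem_ofPred_eq, mem_preimage, MapsTo, h]

end CircleDiffeo

/-- The union of an open set and the interior of its complement is residual. -/
theorem IsOpen.union_interior_compl_mem_residual {X : Type*} [TopologicalSpace X] {G : Set X}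
    (hG : IsOpen G) : G ∪ interior Gᶜ ∈ residual X := by
  refine residual_of_dense_open (hG.union isOpen_interior) ?_
  rw [dense_iff_closure_eq, closure_union, interior_compl, ← compl_subset_iff_union]
  exact subset_closure

namespace CircleDiffeo

variable {r s : ℕ}

/-- For generic systems, if no word maps `J` into `V`, then the same holds for all systems
close by. -/
theorem eventually_residual_not_mapsTo (i₀ : Fin s) :
    ∀ᶠ f in residual (MorseSmaleSSP r s i₀), ∀ b ∈ TopologicalSpace.countableBasis UnitAddCircle,
      ∀ T : Set (Set UnitAddCircle), T.Finite → T ⊆ TopologicalSpace.countableBasis UnitAddCircle →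
        (∀ w ≠ [], ¬ MapsTo (act f.1 w) (closure b) (⋃₀ T)) →
        ∀ᶠ g : MorseSmaleSSP r s i₀ in 𝓝 f, ∀ w ≠ [],
          ¬ MapsTo (act g.1 w) (closure b) (⋃₀ T) := by
  have hcb := TopologicalSpace.countable_countableBasis UnitAddCircle
  have hct := Set.countable_ofPred_finite_subset hcb
  have key : ∀ᶠ f in residual (MorseSmaleSSP r s i₀),
      ∀ b ∈ TopologicalSpace.countableBasis UnitAddCircle,
      ∀ T ∈ {T : Set (Set UnitAddCircle) |
        T.Finite ∧ T ⊆ TopologicalSpace.countableBasis UnitAddCircle},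
      (∀ w ≠ [], ¬ MapsTo (act f.1 w) (closure b) (⋃₀ T)) →
        ∀ᶠ g : MorseSmaleSSP r s i₀ in 𝓝 f, ∀ w ≠ [],
          ¬ MapsTo (act g.1 w) (closure b) (⋃₀ T) := by
    refine (eventually_countable_ball hcb).2 fun b _ => (eventually_countable_ball hct).2
      fun T hT => ?_
    have hTo : IsOpen (⋃₀ T) := isOpen_sUnion fun V hV =>
      TopologicalSpace.isOpen_of_mem_countableBasis (hT.2 hV)
    have hG : IsOpen {f : MorseSmaleSSP r s i₀ |
        ∃ w, w ≠ [] ∧ MapsTo (act f.1 w) (closure b) (⋃₀ T)} := by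
      simp only [ofPred_exists, ofPred_and]
      exact isOpen_iUnion fun w => isOpen_const.inter
        ((isOpen_setOf_mapsTo_act w isClosed_closure.isCompact hTo).preimage
          continuous_subtype_val)
    filter_upwards [hG.union_interior_compl_mem_residual] with f hf hno
    rcases hf with ⟨w, hw, h⟩ | hf
    · exact absurd h (hno w hw)
    · filter_upwards [mem_interior_iff_mem_nhds.1 hf] with g hg w hw h
      exact hg ⟨w, hw, h⟩
  filter_upwards [key] with f hf b hb T hT hTs
  exact hf b hb T ⟨hT, hTs⟩

end CircleDiffeo

/-- Between a compact set and an open set containing it there is a finite union of basic sets. -/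
theorem IsCompact.exists_finite_sUnion_countableBasis {X : Type*} [TopologicalSpace X]
    [SecondCountableTopology X] {C O : Set X} (hC : IsCompact C) (hO : IsOpen O) (hCO : C ⊆ O) :
    ∃ T : Set (Set X), T.Finite ∧ T ⊆ TopologicalSpace.countableBasis X ∧ C ⊆ ⋃₀ T ∧ ⋃₀ T ⊆ O := by
  obtain ⟨T, hT, hTf, hCT⟩ := hC.elim_finite_subcover_image (c := id)
    (b := {b ∈ TopologicalSpace.countableBasis X | b ⊆ O})
    (fun b hb => TopologicalSpace.isOpen_of_mem_countableBasis hb.1) fun x hx => by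
      obtain ⟨b, hb, hxb, hbO⟩ := (TopologicalSpace.isBasis_countableBasis
        X).exists_subset_of_mem_open (hCO hx) hO
      exact mem_biUnion (show b ∈ _ from ⟨hb, hbO⟩) hxb
  simp only [id_eq, ← sUnion_eq_biUnion] at hCT
  exact ⟨T, hTf, fun b hb => (hT hb).1, hCT, sUnion_subset fun b hb => (hT hb).2⟩

/-! ### Stability of orbit closures of sinks for generic systems. -/

namespace CircleDiffeo

variable {r s : ℕ}

theorem isFiberLyapunovStable_closure_orbit (hr : 1 ≤ r) {i₀ : Fin s}
    (f : MorseSmaleSSP r s i₀)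
    (hf : ∀ b ∈ TopologicalSpace.countableBasis UnitAddCircle, ∀ T : Set (Set UnitAddCircle),
      T.Finite → T ⊆ TopologicalSpace.countableBasis UnitAddCircle →
        (∀ w ≠ [], ¬ MapsTo (act f.1 w) (closure b) (⋃₀ T)) →
        ∀ᶠ g : MorseSmaleSSP r s i₀ in 𝓝 f, ∀ w ≠ [],
          ¬ MapsTo (act g.1 w) (closure b) (⋃₀ T))
    {a : UnitAddCircle} (ha : (f.1 i₀).IsSink a) :
    IsFiberLyapunovStable (fun i => (f.1 i : UnitAddCircle → UnitAddCircle))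
      (closure (semigroupOrbit (fun i => (f.1 i : UnitAddCircle → UnitAddCircle)) a)) := by
  have hcont : ∀ (g : Fin s → CircleDiffeo r) (w : List (Fin s)), Continuous (act g w) := by
    intro g w
    induction w with
    | nil => exact continuous_id
    | cons i w ih => exact (g i).toHomeomorph.continuous.comp ih
  refine isFiberLyapunovStable_of_safeSet isClosed_closure.isCompact isClosed_closure
    (mapsTo_closure_semigroupOrbit (fun i => (f.1 i).toHomeomorph.continuous) a) fun U hU hKU => ?_
  refine closure_semigroupOrbit_subset_interior_safeSet (fun i => (f.1 i).toHomeomorph) i₀ ha.1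
    ⟨_, Function.minimalPeriod_pos_of_mem_periodicPts ha.1, ha.isTrapped hr⟩ hU hKU ?_
    (fun C hC hne hinv => (f.1 i₀).exists_periodic_of_isClosed f.2.1 hC hne hinv)
    fun p hp => ⟨_, Function.minimalPeriod_pos_of_mem_periodicPts hp,
      Function.iterate_minimalPeriod, ?_⟩
  swap
  · rcases lt_or_gt_of_ne (f.2.2.2 p hp) with h | h
    · exact Or.inl (IsSink.isTrapped hr ⟨hp, h⟩)
    · exact Or.inr ((f.1 i₀).isTrapped_symm_of_one_lt hr h)
  -- `⋃₀ T` covers the complement of `U` and misses the orbit closure.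
  obtain ⟨T, hT, hTs, hUT, hTK⟩ := hU.isClosed_compl.isCompact.exists_finite_sUnion_countableBasis
    (isClosed_closure (s := semigroupOrbit
      (fun i => (f.1 i : UnitAddCircle → UnitAddCircle)) a)).isOpen_compl
    (compl_subset_compl.2 hKU)
  have hTo : IsOpen (⋃₀ T) := isOpen_sUnion fun V hV =>
    TopologicalSpace.isOpen_of_mem_countableBasis (hTs hV)
  obtain ⟨D, hD, hDa⟩ := ha.exists_nhds_mapsTo_iterate hr
  obtain ⟨b, hb, hab, hbD⟩ :=
    (TopologicalSpace.isBasis_countableBasis UnitAddCircle).exists_closure_subset hD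
  -- The point `a ∈ b` is itself a witness, since its orbit misses `⋃₀ T`.
  have hno : ∀ w ≠ [], ¬ MapsTo (act f.1 w) (closure b) (⋃₀ T) := fun w hw h =>
    hTK (h (subset_closure hab)) (subset_closure (wordAct_mem_semigroupOrbit _ a hw))
  have htw : Filter.Tendsto (fun t => (⟨twist i₀ f.1 t, by rw [twist_self]; exact f.2⟩ :
      MorseSmaleSSP r s i₀)) (𝓝 0) (𝓝 f) :=
    tendsto_subtype_rng.2 (tendsto_twist i₀ f.1)
  have hsub := subset_interior_safeSet_of_twist i₀ f.1 a (⋃₀ T) (by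
    filter_upwards [htw.eventually (hf b hb T hT hTs hno)] with t ht w hw haT
    -- The twist leaves the map `i₀` unchanged, so its iterates still contract `D` to `a`. Preceding
    -- `w` by `m` of them carries all of `closure b` into `⋃₀ T`.
    obtain ⟨m, hm⟩ := hDa _ ((hcont (twist i₀ f.1 t) w).continuousAt.preimage_mem_nhds
      (hTo.mem_nhds haT))
    refine ht (w ++ List.replicate m i₀) (by simp [hw]) fun x hx => ?_
    rw [act, wordAct_append, wordAct_replicate, twist_self]
    exact hm (hbD hx))
  refine hsub.trans (interior_mono fun x hx w => ?_)
  exact not_not.1 fun h => hx w (hUT h)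

end CircleDiffeo

theorem lemma5p3 (r s : ℕ) (hr : 1 ≤ r) (hs : 2 ≤ s) :
    {f : MorseSmaleSSP r s ⟨0, Nat.zero_lt_of_lt hs⟩ |
      ∀ a : UnitAddCircle, (f.1 ⟨0, Nat.zero_lt_of_lt hs⟩).IsSink a →
        IsFiberLyapunovStable (fun i => (f.1 i : UnitAddCircle → UnitAddCircle))
          (closure (semigroupOrbit (fun i => (f.1 i : UnitAddCircle → UnitAddCircle)) a))} ∈
      residual (MorseSmaleSSP r s ⟨0, Nat.zero_lt_of_lt hs⟩) := by
  filter_upwards [CircleDiffeo.eventually_residual_not_mapsTo _] with f hf a ha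
  exact CircleDiffeo.isFiberLyapunovStable_closure_orbit hr f hf ha
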